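/- For integers $m\ge 0$ and $k$, write $[m]=1+q+\cdots+q^{m-1}$ and let ${m\brack k}=\prod_{i=1}^{k}\frac{1-q^{m-i+1}}{1-q^i}$ if $k\ge0$ and ${m\brack k}=0$ if $k<0$ be the $q$-binomial coefficients. For $0\le k\le n$ let $$A_{n,k}(q)={2n\brack n-k}-{2n\brack n-k-1}$$ be the $q$-ballot numbers, and let $A_{n,k}=A_{n,k}(1)=\binom{2n}{n-k}-\binom{2n}{n-k-1}$ (with $\binom{2n}{-1}=0$). For Laurent polynomials $A,B$ in $q$ and a nonzero polynomial $D$ in $q$, all with integer coefficients, $A\equiv B\pmod D$ means that $(A-B)/D$ is again a Laurent polynomial in $q$ with integer coefficients. Let $n,s\ge 1$ and $r,j\ge 0$ be integers with $r+s$ odd and $j\le s$. Then $$\sum_{k=0}^{n} q^{j(k^2+k)-rk}\,[2k+1]^r A_{n,k}(q)^s\equiv 0 \pmod{{2n\brack n}},$$ $$\sum_{k=0}^{n} (-1)^k q^{\binom k2+j(k^2+k)-(r-1)k}\,[2k+1]^r A_{n,k}(q)^s\equiv 0 \pmod{{2n\brack n}}.$$ In particular (at $q=1$), the integers $\sum_{k=0}^{n}(2k+1)^rA_{n,k}^s$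 and $\sum_{k=0}^{n}(-1)^k(2k+1)^rA_{n,k}^s$ are both divisible by $\binom{2n}{n}$. -/

import Mathlib

namespace QBallot

/-- The indeterminate `q`, as an element of the field `ℚ(q)` of rational functions. -/
noncomputable def q : RatFunc ℚ := RatFunc.X

/-- The `q`-integer `[n] = 1 + q + ⋯ + q^(n-1)`. -/
noncomputable def qInt (n : ℕ) : RatFunc ℚ := ∑ i ∈ Finset.range n, q ^ i

/-- The `q`-binomial coefficient: `∏_{i=1}^{k} (1 - q^(n-i+1)) / (1 - q^i)` if `k ≥ 0`,
and `0` if `k < 0`. -/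
noncomputable def qBinom (n k : ℤ) : RatFunc ℚ :=
  if 0 ≤ k then ∏ i ∈ Finset.Icc 1 k, (1 - q ^ (n - i + 1)) / (1 - q ^ i) else 0

/-- The `q`-ballot number `A_{n,k}(q)`. The lower indices are integers, so that
for `k = n` the second term is a `q`-binomial coefficient with lower index `-1`, i.e. `0`. -/
noncomputable def qBallot (n k : ℕ) : RatFunc ℚ :=
  qBinom (2 * n) (n - k) - qBinom (2 * n) (n - k - 1)

/-- The rational function `f` is a Laurent polynomial in `q` with integer coefficients:
a finite sum `∑ cᵢ q^i` with `i ∈ ℤ` and `cᵢ ∈ ℤ`. -/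
def IsLaurent (f : RatFunc ℚ) : Prop :=
  ∃ c : ℤ →₀ ℤ, f = c.sum fun i a => (a : RatFunc ℚ) * q ^ i

/-- Congruence `A ≡ B mod D`: the difference `A - B` is `D` times a
Laurent polynomial in `q` (with integer coefficients). -/
def LaurentModEq (D A B : RatFunc ℚ) : Prop :=
  ∃ L : RatFunc ℚ, IsLaurent L ∧ A - B = D * L

/-- The ballot number `A_{n,k} = C(2n, n-k) - C(2n, n-k-1)` for `0 ≤ k ≤ n`, where
`C(2n, -1) = 0`. -/
def ballot (n k : ℕ) : ℤ :=
  ((2 * n).choose (n - k) : ℤ) - if k < n then ((2 * n).choose (n - k - 1) : ℤ) else 0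

end QBallot

/-! The central `q`-binomial is a product of distinct cyclotomic polynomials, those of order `d`
with `d ≤ 2 * (n % d)`. Divisibility therefore reduces to vanishing at each primitive `d`-th root of
unity `ζ` (`gauss_central_dvd`). At such `ζ`, cut the range of `k` into blocks of length `d` and
reflect each one by `a*d + c ↦ a*d + (d-1-c)`, that is `k ↦ -1-k` modulo `d`. By the `q`-Lucas
theorem and the symmetry of `q`-binomials, the ballot number changes sign
(`aeval_ballotPoly_reflect`); so does `q^(-k) [2k+1]`, while the remaining weights are invariant. As
`r + s` is odd, each block sum equals its own negative. The quotient lies in `ℤ[X]`, so evaluating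
it at `1` gives the integer statements. -/

namespace QBallot

open Polynomial

/-! ### Gaussian binomials over `ℤ[X]`. -/

/-- The Gaussian binomial coefficient as an integer polynomial, by the `q`-Pascal recursion. -/
noncomputable def gauss : ℕ → ℕ → ℤ[X]
  | _, 0 => 1
  | 0, _ + 1 => 0
  | n + 1, k + 1 => gauss n k + X ^ (k + 1) * gauss n (k + 1)

@[simp] theorem gauss_zero_right (n : ℕ) : gauss n 0 = 1 := by cases n <;> rfl

@[simp] theorem gauss_zero_succ (k : ℕ) : gauss 0 (k + 1) = 0 := rfl

theorem gauss_succ_succ (n k : ℕ) :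
    gauss (n + 1) (k + 1) = gauss n k + X ^ (k + 1) * gauss n (k + 1) := rfl

theorem gauss_eq_zero_of_lt {n k : ℕ} (h : n < k) : gauss n k = 0 := by
  induction n generalizing k with
  | zero => obtain ⟨k, rfl⟩ := Nat.exists_eq_succ_of_ne_zero h.ne'; rfl
  | succ n ih =>
    obtain ⟨k, rfl⟩ := Nat.exists_eq_succ_of_ne_zero (by omega : k ≠ 0)
    rw [Nat.succ_eq_add_one, gauss_succ_succ, ih (by omega), ih (by omega)]
    simp

@[simp] theorem gauss_self (n : ℕ) : gauss n n = 1 := by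
  induction n with
  | zero => rfl
  | succ n ih => rw [gauss_succ_succ, ih, gauss_eq_zero_of_lt (Nat.lt_succ_self n)]; simp

theorem eval_one_gauss (n k : ℕ) : (gauss n k).eval 1 = (n.choose k : ℤ) := by
  induction n generalizing k with
  | zero => cases k <;> simp
  | succ n ih =>
    cases k with
    | zero => simp
    | succ k => simp [gauss_succ_succ, ih, Nat.choose_succ_succ]

/-- The product `∏_{i=1}^m (X^i - 1)`. -/
noncomputable def powSubOneFactorial (m : ℕ) : ℤ[X] :=
  ∏ i ∈ Finset.range m, (X ^ (i + 1) - 1)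

theorem powSubOneFactorial_succ (m : ℕ) :
    powSubOneFactorial (m + 1) = powSubOneFactorial m * (X ^ (m + 1) - 1) :=
  Finset.prod_range_succ _ _

theorem powSubOneFactorial_ne_zero (m : ℕ) : powSubOneFactorial m ≠ 0 :=
  Finset.prod_ne_zero_iff.2 fun i _ => X_pow_sub_C_ne_zero (Nat.succ_pos i) (1 : ℤ)

theorem gauss_mul_powSubOneFactorial (a b : ℕ) :
    gauss (a + b) a * powSubOneFactorial a * powSubOneFactorial b =
      powSubOneFactorial (a + b) := by
  induction a generalizing b with
  | zero => simp [powSubOneFactorial]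
  | succ a iha =>
    induction b with
    | zero => simp [powSubOneFactorial]
    | succ b ihb =>
      have h1 := iha (b + 1)
      rw [show a + (b + 1) = a + 1 + b by ring] at h1
      rw [← add_assoc, gauss_succ_succ, powSubOneFactorial_succ (a + 1 + b)]
      rw [powSubOneFactorial_succ b] at h1 ⊢
      rw [powSubOneFactorial_succ a] at ihb ⊢
      linear_combination (X ^ (a + 1) - 1) * h1 + X ^ (a + 1) * (X ^ (b + 1) - 1) * ihb

theorem gauss_symm_add (a b : ℕ) : gauss (a + b) a = gauss (a + b) b := by
  have h1 := gauss_mul_powSubOneFactorial a b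
  have h2 := gauss_mul_powSubOneFactorial b a
  rw [add_comm b a, ← h1, mul_assoc, mul_assoc, mul_comm (powSubOneFactorial b)] at h2
  exact (mul_right_cancel₀ (mul_ne_zero (powSubOneFactorial_ne_zero a)
    (powSubOneFactorial_ne_zero b)) h2).symm

/-! ### Cyclotomic factorization and the divisibility criterion. -/

/-- Each multiple of `d` up to `m` contributes one factor. The free bound `M` lets the cases `n` and
`2 * n` share an index set. -/
theorem powSubOneFactorial_eq_prod_cyclotomic {m M : ℕ} (h : m ≤ M) :
    powSubOneFactorial m = ∏ d ∈ Finset.Icc 1 M, cyclotomic d ℤ ^ (m / d) := by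
  induction m with
  | zero => simp [powSubOneFactorial]
  | succ m ih =>
    have hdiv : (m + 1).divisors = (Finset.Icc 1 M).filter (· ∣ m + 1) := by
      ext d
      simp only [Nat.mem_divisors, Finset.mem_filter, Finset.mem_Icc]
      constructor
      · rintro ⟨hd, -⟩
        exact ⟨⟨Nat.pos_of_dvd_of_pos hd m.succ_pos, (Nat.le_of_dvd m.succ_pos hd).trans h⟩, hd⟩
      · exact fun hd => ⟨hd.2, m.succ_ne_zero⟩
    rw [powSubOneFactorial_succ, ih (by omega), ← prod_cyclotomic_eq_X_pow_sub_one m.succ_pos,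
      Nat.succ_eq_add_one, hdiv, Finset.prod_filter, ← Finset.prod_mul_distrib]
    refine Finset.prod_congr rfl fun d _ => ?_
    rw [Nat.succ_div]
    split_ifs <;> simp [pow_succ]

theorem two_mul_div_eq (n d : ℕ) (hd : 0 < d) :
    2 * n / d = 2 * (n / d) + if d ≤ 2 * (n % d) then 1 else 0 := by
  have hlt := Nat.mod_lt n hd
  have hn := Nat.div_add_mod n d
  have : 2 * n = 2 * (n % d) + d * (2 * (n / d)) := by linarith
  rw [this, Nat.add_mul_div_left _ _ hd, add_comm]
  congr 1
  split_ifs with h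
  · rw [Nat.div_eq_of_lt_le] <;> omega
  · exact Nat.div_eq_of_lt (by omega)

/-- The central Gaussian binomial coefficient is a product of distinct cyclotomic polynomials. -/
theorem gauss_central_eq_prod_cyclotomic (n : ℕ) :
    gauss (2 * n) n =
      ∏ d ∈ (Finset.Icc 1 (2 * n)).filter (fun d => d ≤ 2 * (n % d)), cyclotomic d ℤ := by
  have h := gauss_mul_powSubOneFactorial n n
  rw [← two_mul, mul_assoc] at h
  refine mul_right_cancel₀ (mul_ne_zero (powSubOneFactorial_ne_zero n)
    (powSubOneFactorial_ne_zero n)) (h.trans ?_)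
  rw [powSubOneFactorial_eq_prod_cyclotomic (le_refl (2 * n)),
    powSubOneFactorial_eq_prod_cyclotomic (by omega : n ≤ 2 * n), Finset.prod_filter,
    ← Finset.prod_mul_distrib, ← Finset.prod_mul_distrib]
  refine Finset.prod_congr rfl fun d hd => ?_
  rw [two_mul_div_eq n d (Finset.mem_Icc.1 hd).1]
  split_ifs <;> ring

/-- Distinct cyclotomic polynomials are relatively prime, and each is the minimal polynomial over
`ℤ` of a primitive root, so one root per order suffices. -/
theorem gauss_central_dvd {n : ℕ} {P : ℤ[X]}
    (h : ∀ (d : ℕ) (ζ : ℂ), 0 < d → d ≤ 2 * (n % d) → IsPrimitiveRoot ζ d → aeval ζ P = 0) :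
    gauss (2 * n) n ∣ P := by
  rw [gauss_central_eq_prod_cyclotomic]
  refine Finset.prod_dvd_of_isRelPrime ?_ ?_
  · intro d hd e he hde
    have hd1 : 0 < d := by simp at hd; omega
    have he1 : 0 < e := by simp at he; omega
    refine ((cyclotomic.irreducible hd1).isRelPrime_iff_not_dvd).2 fun hdvd => hde ?_
    refine cyclotomic_injective (R := ℤ) ?_
    exact eq_of_monic_of_associated (cyclotomic.monic d ℤ) (cyclotomic.monic e ℤ)
      ((cyclotomic.irreducible hd1).associated_of_dvd (cyclotomic.irreducible he1) hdvd)
  · intro d hd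
    obtain ⟨hd1, hd2⟩ := Finset.mem_filter.1 hd
    have hd0 : 0 < d := (Finset.mem_Icc.1 hd1).1
    have hζ := Complex.isPrimitiveRoot_exp d hd0.ne'
    rw [cyclotomic_eq_minpoly hζ hd0]
    exact minpoly.isIntegrallyClosed_dvd (hζ.isIntegral hd0) (h d _ hd0 hd2 hζ)

/-! ### Gaussian binomials at roots of unity. -/

section RootOfUnity

variable {d : ℕ} {ζ : ℂ}

theorem aeval_gauss_order_eq_zero (hζ : IsPrimitiveRoot ζ d) {c : ℕ} (hc : 0 < c) (hcd : c < d) :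
    aeval ζ (gauss d c) = 0 := by
  have h := gauss_mul_powSubOneFactorial c (d - c)
  rw [Nat.add_sub_cancel' hcd.le] at h
  have key : ∀ m, m < d → aeval ζ (powSubOneFactorial m) ≠ 0 := by
    intro m hm
    simp only [powSubOneFactorial, map_prod, map_sub, map_pow, aeval_X, map_one]
    refine Finset.prod_ne_zero_iff.2 fun i hi => sub_ne_zero.2 ?_
    exact hζ.pow_ne_one_of_pos_of_lt i.succ_ne_zero (by simp at hi; omega)
  obtain ⟨e, rfl⟩ := Nat.exists_eq_succ_of_ne_zero (by omega : d ≠ 0)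
  have h' := congrArg (aeval ζ) h
  rw [Nat.succ_eq_add_one, powSubOneFactorial_succ e] at h'
  simp only [map_mul, map_sub, map_pow, aeval_X, map_one, hζ.pow_eq_one, sub_self, mul_zero] at h'
  simpa [key c hcd, key (e + 1 - c) (by omega)] using h'

/-- The `q`-Lucas theorem. -/
theorem aeval_gauss_lucas (hζ : IsPrimitiveRoot ζ d) (N K : ℕ) {b c : ℕ} (hb : b < d)
    (hc : c < d) :
    aeval ζ (gauss (N * d + b) (K * d + c)) = (N.choose K : ℂ) * aeval ζ (gauss b c) := by
  -- Induction on the whole row index lets the Pascal recursion cross block boundaries.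
  induction hM : N * d + b generalizing N K b c with
  | zero =>
    have hN : N = 0 := by
      rcases Nat.eq_zero_or_pos N with h | h
      · exact h
      · have := Nat.mul_pos h (by omega : 0 < d); omega
    subst hN
    obtain rfl : b = 0 := by omega
    rcases K with _ | K
    · simp
    · have : (K + 1) * d + c ≠ 0 := by 
        have : 0 < (K + 1) * d := Nat.mul_pos K.succ_pos (by omega)
        omega
      rw [gauss_eq_zero_of_lt (by omega)]; simp
  | succ M ih =>
    have hpow : ∀ e, ζ ^ (K * d + e) = ζ ^ e := fun e => by
      rw [pow_add, mul_comm K, pow_mul, hζ.pow_eq_one, one_pow, one_mul]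
    rcases b with _ | b
    · obtain ⟨N, rfl⟩ := Nat.exists_eq_succ_of_ne_zero (by rintro rfl; omega : N ≠ 0)
      obtain ⟨e, rfl⟩ := Nat.exists_eq_succ_of_ne_zero (by omega : d ≠ 0)
      simp only [Nat.succ_eq_add_one] at *
      have hM' : N * (e + 1) + e = M := by rw [add_mul] at hM; omega
      rcases c with _ | c
      · rcases K with _ | K
        · simp
        · rw [show (K + 1) * (e + 1) + 0 = (K * (e + 1) + e) + 1 by ring, gauss_succ_succ]
          have h2 := ih N (K + 1) (b := e) (c := 0) (by omega) (by omega) hM'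
          rw [show (K + 1) * (e + 1) + 0 = (K * (e + 1) + e) + 1 by ring] at h2
          have h3 := hpow 0
          rw [show (K + 1) * (e + 1) + 0 = (K * (e + 1) + e) + 1 by ring] at h3
          simp only [map_add, map_mul, map_pow, aeval_X, h2, h3,
            ih N K (b := e) (c := e) (by omega) (by omega) hM']
          simp [Nat.choose_succ_succ]
      · rw [← add_assoc, gauss_succ_succ]
        have h2 := ih N K (b := e) (c := c + 1) (by omega) (by omega) hM'
        rw [← add_assoc] at h2
        have h3 := hpow (c + 1)
        rw [← add_assoc] at h3
        -- The two Pascal terms together form a multiple of the interior entry of row `d`, which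
        -- vanishes at `ζ`.
        have h4 := aeval_gauss_order_eq_zero hζ (c := c + 1) (by omega) hc
        rw [gauss_succ_succ] at h4
        simp only [map_add, map_mul, map_pow, aeval_X] at h4
        simp only [map_add, map_mul, map_pow, aeval_X, h2, h3,
          ih N K (b := e) (c := c) (by omega) (by omega) hM', gauss_zero_succ, map_zero]
        linear_combination (N.choose K : ℂ) * h4
    · have hM' : N * d + b = M := by omega
      rcases c with _ | c
      · rcases K with _ | K
        · simp
        · obtain ⟨e, rfl⟩ := Nat.exists_eq_succ_of_ne_zero (by omega : d ≠ 0)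
          simp only [Nat.succ_eq_add_one] at *
          rw [show (K + 1) * (e + 1) + 0 = (K * (e + 1) + e) + 1 by ring, gauss_succ_succ]
          have h2 := ih N (K + 1) (b := b) (c := 0) (by omega) (by omega) hM'
          rw [show (K + 1) * (e + 1) + 0 = (K * (e + 1) + e) + 1 by ring] at h2
          have h3 := hpow 0
          rw [show (K + 1) * (e + 1) + 0 = (K * (e + 1) + e) + 1 by ring] at h3
          simp only [map_add, map_mul, map_pow, aeval_X, h2, h3,
            ih N K (b := b) (c := e) (by omega) (by omega) hM']
          rw [gauss_eq_zero_of_lt (by omega : b < e)]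
          simp
      · rw [← add_assoc, gauss_succ_succ]
        have h2 := ih N K (b := b) (c := c + 1) (by omega) (by omega) hM'
        rw [← add_assoc] at h2
        have h3 := hpow (c + 1)
        rw [← add_assoc] at h3
        simp only [map_add, map_mul, map_pow, aeval_X, h2, h3,
          ih N K (b := b) (c := c) (by omega) (by omega) hM', gauss_succ_succ]
        ring

end RootOfUnity

/-! ### Ballot polynomials and their reflection in a block. -/

/-- The Gaussian binomial coefficient with integer lower index. -/
noncomputable def gaussInt (n : ℕ) (k : ℤ) : ℤ[X] :=
  if 0 ≤ k then gauss n k.toNat else 0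

theorem gaussInt_natCast (n k : ℕ) : gaussInt n k = gauss n k := by simp [gaussInt]

theorem gaussInt_of_neg (n : ℕ) {k : ℤ} (hk : k < 0) : gaussInt n k = 0 :=
  if_neg (not_le.2 hk)

theorem gaussInt_symm (n : ℕ) (k : ℤ) : gaussInt n (n - k) = gaussInt n k := by
  rcases lt_or_ge k 0 with hk | hk
  · rw [gaussInt_of_neg n hk, gaussInt, if_pos (by omega), gauss_eq_zero_of_lt (by omega)]
  · lift k to ℕ using hk
    rcases lt_or_ge n k with hn | hn
    · rw [gaussInt_of_neg n (by omega), gaussInt_natCast, gauss_eq_zero_of_lt hn]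
    · obtain ⟨m, rfl⟩ := Nat.exists_eq_add_of_le hn
      rw [gaussInt_natCast, gauss_symm_add, ← gaussInt_natCast]
      congr 1; push_cast; ring

/-- For negative `t`, borrowing from `K` gives residue `d + t`, which exceeds `b` by `ht'`, so both
sides vanish. -/
theorem aeval_gaussInt_lucas {d : ℕ} {ζ : ℂ} (hζ : IsPrimitiveRoot ζ d) (N K : ℕ) {b : ℕ} {t : ℤ}
    (hb : b < d) (ht : t < d) (ht' : (b : ℤ) < d + t) :
    aeval ζ (gaussInt (N * d + b) (K * d + t)) =
      (N.choose K : ℂ) * aeval ζ (gaussInt b t) := by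
  rcases lt_or_ge t 0 with h | h
  · rw [gaussInt_of_neg b h]
    rcases K with _ | K
    · rw [gaussInt_of_neg _ (by simpa using h)]; simp
    · obtain ⟨c, hc⟩ := Int.eq_ofNat_of_zero_le (by omega : (0 : ℤ) ≤ d + t)
      have : ((K + 1 : ℕ) : ℤ) * d + t = ((K * d + c : ℕ) : ℤ) := by
        push_cast; linear_combination hc
      rw [this, gaussInt_natCast, aeval_gauss_lucas hζ N K hb (by omega),
        gauss_eq_zero_of_lt (by omega)]
      simp
  · lift t to ℕ using h
    rw [gaussInt_natCast, ← aeval_gauss_lucas hζ N K hb (by omega), ← gaussInt_natCast]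
    push_cast; rfl

/-- The `q`-ballot number as an integer polynomial. -/
noncomputable def ballotPoly (n k : ℕ) : ℤ[X] :=
  gaussInt (2 * n) (n - k) - gaussInt (2 * n) (n - k - 1)

theorem ballotPoly_eq_zero_of_lt {n k : ℕ} (h : n < k) : ballotPoly n k = 0 := by
  rw [ballotPoly, gaussInt_of_neg _ (by omega), gaussInt_of_neg _ (by omega), sub_self]

/-- With `b = n % d` and `2b = d + β`, Lucas leaves row `β` with columns `b-c` and `b-c-1`. The
reflected index gives columns `β-(b-c-1)` and `β-(b-c)`, so symmetry of row `β` swaps the two terms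
of the difference. -/
theorem aeval_ballotPoly_reflect {n d : ℕ} {ζ : ℂ} (hζ : IsPrimitiveRoot ζ d)
    (hd : d ≤ 2 * (n % d)) {a c : ℕ} (ha : a ≤ n / d) (hc : c < d) :
    aeval ζ (ballotPoly n (a * d + (d - 1 - c))) = -aeval ζ (ballotPoly n (a * d + c)) := by
  have hbd : n % d < d := Nat.mod_lt n (by omega)
  have hn := Nat.div_add_mod n d
  obtain ⟨e, he⟩ := Nat.exists_eq_add_of_le ha
  set b := n % d with hb
  set m := n / d with hm
  obtain ⟨β, hβ⟩ := Nat.exists_eq_add_of_le hd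
  have h2n : 2 * n = (2 * m + 1) * d + β := by linarith
  have hnZ : (n : ℤ) = a * d + e * d + b := by
    rw [← hn, he]; push_cast; ring
  have h2b : (2 : ℤ) * b = d + β := by exact_mod_cast hβ
  have key : ∀ t : ℤ, t < d → (β : ℤ) < d + t →
      aeval ζ (gaussInt (2 * n) (e * d + t)) =
        ((2 * m + 1).choose e : ℂ) * aeval ζ (gaussInt β t) := fun t h1 h2 => by
    rw [h2n]; exact aeval_gaussInt_lucas hζ _ _ (by omega) h1 h2
  have hc' : ((d - 1 - c : ℕ) : ℤ) = d - 1 - c := by omega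
  have e1 : (n : ℤ) - ((a * d + (d - 1 - c) : ℕ) : ℤ) = e * d + (β - (b - c - 1)) := by
    push_cast [hc']; linear_combination hnZ + h2b
  have e2 : (n : ℤ) - ((a * d + (d - 1 - c) : ℕ) : ℤ) - 1 = e * d + (β - (b - c)) := by
    push_cast [hc']; linear_combination hnZ + h2b
  have e3 : (n : ℤ) - ((a * d + c : ℕ) : ℤ) = e * d + (b - c) := by
    push_cast; linear_combination hnZ
  have e4 : (n : ℤ) - ((a * d + c : ℕ) : ℤ) - 1 = e * d + (b - c - 1) := by
    push_cast; linear_combination hnZ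
  rw [ballotPoly, ballotPoly, e2, e1, e4, e3, map_sub, map_sub, key _ (by omega) (by omega),
    key _ (by omega) (by omega), key _ (by omega) (by omega), key _ (by omega) (by omega),
    gaussInt_symm, gaussInt_symm]
  ring

theorem sum_mul_ballot_pow_eq_zero {n d r s : ℕ} {ζ : ℂ} (hζ : IsPrimitiveRoot ζ d)
    (hd : d ≤ 2 * (n % d)) (hd0 : 0 < d) (hrs : Odd (r + s)) (hs : 1 ≤ s) (w : ℕ → ℂ)
    (hw : ∀ a c, c < d → w (a * d + (d - 1 - c)) = (-1) ^ r * w (a * d + c)) :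
    ∑ k ∈ Finset.range (n + 1), w k * aeval ζ (ballotPoly n k) ^ s = 0 := by
  set f : ℕ → ℂ := fun k => w k * aeval ζ (ballotPoly n k) ^ s with hf
  have hlt : n < (n / d + 1) * d := Nat.lt_div_mul_add hd0 |>.trans_eq (by ring)
  -- The last block is completed by zero terms: ballot polynomials vanish for `k > n`, and `s ≥ 1`.
  have hext : ∑ k ∈ Finset.range (n + 1), f k = ∑ k ∈ Finset.range ((n / d + 1) * d), f k := by
    refine Finset.sum_subset (Finset.range_mono hlt) fun k _ hk => ?_
    rw [hf]
    simp only
    rw [ballotPoly_eq_zero_of_lt (by simpa using hk), map_zero, zero_pow (by omega), mul_zero]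
  have hblock : ∀ M : ℕ, ∑ k ∈ Finset.range (M * d), f k =
      ∑ a ∈ Finset.range M, ∑ c ∈ Finset.range d, f (a * d + c) := fun M => by
    induction M with
    | zero => simp
    | succ M ih => rw [add_mul, one_mul, Finset.sum_range_add, ih, Finset.sum_range_succ]
  rw [hext, hblock]
  refine Finset.sum_eq_zero fun a ha => ?_
  have hanti : ∑ c ∈ Finset.range d, f (a * d + c) = -∑ c ∈ Finset.range d, f (a * d + c) := by
    conv_lhs => rw [← Finset.sum_range_reflect]
    rw [← Finset.sum_neg_distrib]
    refine Finset.sum_congr rfl fun c hc => ?_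
    have hc' := Finset.mem_range.1 hc
    have hsign : (-1 : ℂ) ^ r * (-1) ^ s = -1 := by rw [← pow_add, hrs.neg_one_pow]
    simp only [hf]
    rw [hw a c hc', aeval_ballotPoly_reflect hζ hd (by simpa [Nat.lt_succ_iff] using ha) hc',
      neg_pow]
    linear_combination w (a * d + c) * aeval ζ (ballotPoly n (a * d + c)) ^ s * hsign
  exact self_eq_neg.1 hanti

/-! ### Transfer to rational functions and to `q = 1`. -/

theorem IsLaurent.add {f g : RatFunc ℚ} (hf : IsLaurent f) (hg : IsLaurent g) :
    IsLaurent (f + g) := by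
  obtain ⟨c, rfl⟩ := hf
  obtain ⟨e, rfl⟩ := hg
  refine ⟨c + e, (Finsupp.sum_add_index' (by simp) fun i a b => ?_).symm⟩
  push_cast; ring

theorem isLaurent_monomial (i a : ℤ) : IsLaurent ((a : RatFunc ℚ) * q ^ i) :=
  ⟨Finsupp.single i a, by simp⟩

theorem q_ne_zero : q ≠ 0 := RatFunc.X_ne_zero

theorem q_pow_ne_one {m : ℕ} (hm : m ≠ 0) : q ^ m ≠ 1 := by
  intro h
  have h' : algebraMap ℚ[X] (RatFunc ℚ) (X ^ m) = algebraMap ℚ[X] (RatFunc ℚ) 1 := by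
    simpa [q, RatFunc.algebraMap_X] using h
  have h2 := congrArg natDegree (RatFunc.algebraMap_injective ℚ h')
  simp [hm] at h2

theorem isLaurent_zpow_mul_aeval (m : ℤ) (P : ℤ[X]) : IsLaurent (q ^ m * aeval q P) := by
  induction P using Polynomial.induction_on' with
  | add P R hP hR => rw [map_add, mul_add]; exact hP.add hR
  | monomial i a =>
    have : q ^ m * aeval q (monomial i a) = (a : RatFunc ℚ) * q ^ (m + i) := by
      rw [aeval_monomial, zpow_add₀ q_ne_zero, zpow_natCast, eq_intCast]; ring
    rw [this]
    exact isLaurent_monomial _ _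

theorem aeval_gauss_eq_prod {K : Type*} [Field K] [Algebra ℤ K] {x : K} (hx : x ≠ 0)
    (hx1 : ∀ m : ℕ, m ≠ 0 → x ^ m ≠ 1) (n k : ℕ) :
    aeval x (gauss n k) =
      ∏ i ∈ Finset.range k, (1 - x ^ ((n : ℤ) - i)) / (1 - x ^ (i + 1)) := by
  have hne : ∀ m : ℕ, 1 - x ^ (m + 1) ≠ 0 := fun m => sub_ne_zero.2 (hx1 _ m.succ_ne_zero).symm
  induction n generalizing k with
  | zero =>
    rcases k with _ | k
    · simp
    -- The factor at `i = 0` is `1 - x ^ 0 = 0`.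
    · rw [Finset.prod_range_succ']; simp
  | succ n ih =>
    rcases k with _ | k
    · simp
    · rw [gauss_succ_succ, map_add, map_mul, map_pow, aeval_X, ih, ih, Finset.prod_range_succ]
      have h1 : ∏ i ∈ Finset.range (k + 1),
          (1 - x ^ (((n + 1 : ℕ) : ℤ) - i)) / (1 - x ^ (i + 1)) =
          (1 - x ^ (n + 1)) / (1 - x ^ (k + 1)) *
            ∏ i ∈ Finset.range k, (1 - x ^ ((n : ℤ) - i)) / (1 - x ^ (i + 1)) := by
        rw [Finset.prod_div_distrib, Finset.prod_div_distrib, Finset.prod_range_succ',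
          Finset.prod_range_succ (fun i => 1 - x ^ (i + 1))]
        have h2 : ∀ i : ℕ, ((n + 1 : ℕ) : ℤ) - ((i + 1 : ℕ) : ℤ) = n - i := fun i => by
          push_cast; ring
        have h3 : x ^ (((n + 1 : ℕ) : ℤ) - ((0 : ℕ) : ℤ)) = x ^ (n + 1) := by
          rw [← zpow_natCast]; simp
        simp only [h2, h3]
        rw [div_mul_div_comm]
        ring
      rw [h1]
      have h4 : x ^ (k + 1) * x ^ ((n : ℤ) - k) = x ^ (n + 1) := by
        rw [← zpow_natCast, ← zpow_natCast, ← zpow_add₀ hx]; congr 1; push_cast; ring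
      have := hne k
      field_simp
      linear_combination
        (-∏ i ∈ Finset.range k, (1 - x ^ ((n : ℤ) - i)) / (1 - x ^ (i + 1))) * h4

theorem qBinom_eq_aeval (n : ℕ) (k : ℤ) : qBinom n k = aeval q (gaussInt n k) := by
  rw [qBinom]
  split_ifs with hk
  · lift k to ℕ using hk
    rw [gaussInt_natCast, aeval_gauss_eq_prod q_ne_zero fun m => q_pow_ne_one]
    refine Finset.prod_nbij' (fun i => (i - 1).toNat) (fun i => (i : ℤ) + 1) ?_ ?_ ?_ ?_ ?_
    · intro i hi; simp at hi ⊢; omega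
    · intro i hi; simp at hi ⊢; omega
    · intro i hi; simp at hi ⊢; omega
    · intro i hi; simp
    · intro i hi
      obtain ⟨m, hm⟩ := Int.eq_ofNat_of_zero_le (by simp at hi; omega : 0 ≤ i - 1)
      obtain rfl : i = m + 1 := by omega
      have e : (n : ℤ) - (m + 1) + 1 = n - m := by ring
      simp only [e, add_sub_cancel_right, Int.toNat_natCast]
      norm_cast
  · rw [gaussInt_of_neg n (not_le.1 hk), map_zero]

theorem qBallot_eq_aeval (n k : ℕ) : qBallot n k = aeval q (ballotPoly n k) := by
  rw [qBallot, ballotPoly, map_sub, ← qBinom_eq_aeval, ← qBinom_eq_aeval]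
  push_cast; rfl

theorem eval_one_ballotPoly {n k : ℕ} (hk : k ≤ n) : (ballotPoly n k).eval 1 = ballot n k := by
  have h1 : (n : ℤ) - k = ((n - k : ℕ) : ℤ) := by omega
  rw [ballotPoly, ballot, eval_sub, h1, gaussInt_natCast, eval_one_gauss]
  congr 1
  split_ifs with h
  · rw [show ((n - k : ℕ) : ℤ) - 1 = ((n - k - 1 : ℕ) : ℤ) by omega, gaussInt_natCast,
      eval_one_gauss]
  · rw [gaussInt_of_neg _ (by omega), eval_zero]

/-! ### Vanishing and divisibility of the ballot sums. -/

/-- The sum `∑ σ(k) q^(e(k) - rk) [2k+1]^r A_{n,k}(q)^s`, multiplied by `q^(rn)`. -/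
noncomputable def ballotSumPoly (σ : ℕ → ℤ) (e : ℕ → ℕ) (n r s : ℕ) : ℤ[X] :=
  ∑ k ∈ Finset.range (n + 1), C (σ k) * X ^ (e k + r * (n - k)) *
    (∑ i ∈ Finset.range (2 * k + 1), X ^ i) ^ r * ballotPoly n k ^ s

theorem zpow_eq_of_eq_add_mul {d : ℕ} {ζ : ℂ} (hζ : IsPrimitiveRoot ζ d) (hζ0 : ζ ≠ 0)
    {x y z : ℤ} (h : x = y + d * z) : ζ ^ x = ζ ^ y := by
  rw [h, zpow_add₀ hζ0, zpow_mul, zpow_natCast, hζ.pow_eq_one, one_zpow, mul_one]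

theorem aeval_ballotSumPoly_eq_zero {σ : ℕ → ℤ} {e : ℕ → ℕ} {n r s d : ℕ} {ζ : ℂ}
    (hs : 1 ≤ s) (hrs : Odd (r + s)) (hd0 : 0 < d) (hd : d ≤ 2 * (n % d))
    (hζ : IsPrimitiveRoot ζ d)
    (hσ : ∀ a c, c < d → (σ (a * d + (d - 1 - c)) : ℂ) * ζ ^ e (a * d + (d - 1 - c)) =
      σ (a * d + c) * ζ ^ e (a * d + c)) :
    aeval ζ (ballotSumPoly σ e n r s) = 0 := by
  have hζ0 : ζ ≠ 0 := hζ.ne_zero hd0.ne'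
  have hd1 : 1 < d := by
    rcases Nat.lt_or_ge 1 d with h | h
    · exact h
    · obtain rfl : d = 1 := by omega
      simp [Nat.mod_one] at hd
  have hζ1 : ζ - 1 ≠ 0 := sub_ne_zero.2 (hζ.ne_one hd1)
  -- `y k = (ζ^(k+1) - ζ^(-k)) / (ζ - 1)`; reflection exchanges the exponents `k+1` and `-k` modulo
  -- `d`.
  set y : ℕ → ℂ := fun k => ζ ^ (-(k : ℤ)) * ∑ i ∈ Finset.range (2 * k + 1), ζ ^ i with hy
  have hyk : ∀ k, y k * (ζ - 1) = ζ ^ ((k : ℤ) + 1) - ζ ^ (-(k : ℤ)) := fun k => by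
    rw [hy]; simp only
    rw [mul_assoc, geom_sum_mul, mul_sub, mul_one, ← zpow_natCast, ← zpow_add₀ hζ0]
    congr 2; push_cast; ring
  have hanti : ∀ a c, c < d → y (a * d + (d - 1 - c)) = -y (a * d + c) := fun a c hc => by
    have hc' : ((d - 1 - c : ℕ) : ℤ) = d - 1 - c := by omega
    refine mul_right_cancel₀ hζ1 ?_
    rw [neg_mul, hyk, hyk, neg_sub]
    congr 1
    · refine zpow_eq_of_eq_add_mul hζ hζ0 (z := 2 * a + 1) ?_
      push_cast [hc']; ring
    · refine zpow_eq_of_eq_add_mul hζ hζ0 (z := -(2 * a + 1)) ?_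
      push_cast [hc']; ring
  rw [ballotSumPoly, map_sum,
    ← sum_mul_ballot_pow_eq_zero (s := s) hζ hd hd0 hrs hs
      (fun k => ζ ^ (r * n) * (σ k * ζ ^ e k) * y k ^ r) ?_]
  · refine Finset.sum_congr rfl fun k hk => ?_
    have hk' : k ≤ n := by simpa [Nat.lt_succ_iff] using hk
    have h1 : ζ ^ (r * (n - k)) = ζ ^ (r * n) * (ζ ^ (-(k : ℤ))) ^ r := by
      rw [← zpow_natCast, ← zpow_natCast, ← zpow_natCast, ← zpow_mul, ← zpow_add₀ hζ0]
      congr 1; push_cast [hk']; ring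
    simp only [map_mul, map_pow, map_sum, aeval_X, hy, mul_pow, pow_add, h1, eq_intCast,
      map_intCast]
    ring
  · intro a c hc
    rw [hanti a c hc, hσ a c hc, neg_pow]
    ring

/-- A weight `σ(k) q^{e(k)}` that is symmetric in each block at every root of unity gives a
ballot sum divisible by the central binomial coefficient. -/
theorem ballotSum_divisible {σ : ℕ → ℤ} {e : ℕ → ℕ} {n r s : ℕ} (hs : 1 ≤ s)
    (hrs : Odd (r + s))
    (hσ : ∀ (d : ℕ) (ζ : ℂ), IsPrimitiveRoot ζ d → ∀ a c, c < d →
      (σ (a * d + (d - 1 - c)) : ℂ) * ζ ^ e (a * d + (d - 1 - c)) =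
        σ (a * d + c) * ζ ^ e (a * d + c)) :
    LaurentModEq (qBinom (2 * n) n)
      (∑ k ∈ Finset.range (n + 1), (σ k : RatFunc ℚ) * q ^ ((e k : ℤ) - r * k) *
        qInt (2 * k + 1) ^ r * qBallot n k ^ s) 0 ∧
    ((2 * n).choose n : ℤ) ∣
      ∑ k ∈ Finset.range (n + 1), σ k * (2 * (k : ℤ) + 1) ^ r * ballot n k ^ s := by
  obtain ⟨Q, hQ⟩ : gauss (2 * n) n ∣ ballotSumPoly σ e n r s :=
    gauss_central_dvd fun d ζ hd0 hd hζ =>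
      aeval_ballotSumPoly_eq_zero hs hrs hd0 hd hζ (hσ d ζ hζ)
  constructor
  · refine ⟨_, isLaurent_zpow_mul_aeval (-((r * n : ℕ) : ℤ)) Q, ?_⟩
    have hD : qBinom (2 * n) n = aeval q (gauss (2 * n) n) := by
      rw [← gaussInt_natCast, ← qBinom_eq_aeval]; push_cast; rfl
    rw [sub_zero, hD, mul_left_comm, ← map_mul, ← hQ, ballotSumPoly, map_sum, Finset.mul_sum]
    refine Finset.sum_congr rfl fun k hk => ?_
    have hk' : k ≤ n := by simpa [Nat.lt_succ_iff] using hk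
    have h1 : q ^ ((e k : ℤ) - r * k) = q ^ (-((r * n : ℕ) : ℤ)) * q ^ (e k + r * (n - k)) := by
      rw [← zpow_natCast, ← zpow_add₀ q_ne_zero]
      congr 1; push_cast [hk']; ring
    simp only [map_mul, map_pow, map_sum, aeval_X, eq_intCast, map_intCast, h1, qInt,
      qBallot_eq_aeval]
    ring
  · refine ⟨Q.eval 1, ?_⟩
    rw [← eval_one_gauss, ← eval_mul, ← hQ, ballotSumPoly, eval_finsetSum]
    refine Finset.sum_congr rfl fun k hk => ?_
    rw [← eval_one_ballotPoly (by simpa [Nat.lt_succ_iff] using hk)]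
    simp [eval_finsetSum]

/-! ### Invariance of the two weights. -/

theorem pow_sq_add_self_reflect {d : ℕ} {ζ : ℂ} (hζ : IsPrimitiveRoot ζ d) (j a : ℕ) {c : ℕ}
    (hc : c < d) :
    ζ ^ (j * ((a * d + (d - 1 - c)) ^ 2 + (a * d + (d - 1 - c)))) =
      ζ ^ (j * ((a * d + c) ^ 2 + (a * d + c))) := by
  have hc' : ((d - 1 - c : ℕ) : ℤ) = d - 1 - c := by omega
  rw [← zpow_natCast, ← zpow_natCast]
  refine zpow_eq_of_eq_add_mul hζ (hζ.ne_zero (by omega))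
    (z := j * (d - 1 - 2 * c) * (2 * a + 1)) ?_
  push_cast [hc']; ring

theorem two_mul_choose_succ_two (k : ℕ) : 2 * ((k + 1).choose 2 : ℤ) = k * (k + 1) := by
  have h2 := Finset.sum_range_id_mul_two (k + 1)
  rw [Finset.sum_range_id, ← Nat.choose_two_right] at h2
  zify at h2
  push_cast at h2
  linear_combination h2

/-- The exponents of `ζ` differ by `d(d-1-2c)(2a+1)/2`. For odd `d` this is a multiple of `d` and
the signs agree; for `d = 2h` it is an odd multiple of `h`, and `ζ^h = -1` cancels the sign change.
-/
theorem neg_one_pow_mul_pow_choose_reflect {d : ℕ} {ζ : ℂ} (hζ : IsPrimitiveRoot ζ d) (a : ℕ)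
    {c : ℕ} (hc : c < d) :
    (-1 : ℂ) ^ (a * d + (d - 1 - c)) * ζ ^ ((a * d + (d - 1 - c) + 1).choose 2) =
      (-1) ^ (a * d + c) * ζ ^ ((a * d + c + 1).choose 2) := by
  have hζ0 : ζ ≠ 0 := hζ.ne_zero (by omega)
  have hc' : ((d - 1 - c : ℕ) : ℤ) = d - 1 - c := by omega
  have h1 := two_mul_choose_succ_two (a * d + (d - 1 - c))
  have h2 := two_mul_choose_succ_two (a * d + c)
  push_cast [hc'] at h1 h2
  have hsign : (-1 : ℂ) ^ (a * d + (d - 1 - c)) =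
      (-1) ^ (a * d + c) * (-1) ^ ((d : ℤ) - 1 - 2 * c) := by
    rw [← zpow_natCast, ← zpow_natCast, ← zpow_add₀ (by norm_num)]
    congr 1; push_cast [hc']; ring
  rw [hsign, ← zpow_natCast ζ, ← zpow_natCast ζ]
  rcases Nat.even_or_odd' d with ⟨h, rfl | rfl⟩
  · have hh : ζ ^ h = -1 :=
      (hζ.pow (by omega) (mul_comm 2 h)).eq_neg_one_of_two_right
    have e1 : (((a * (2 * h) + (2 * h - 1 - c) + 1).choose 2 : ℕ) : ℤ) =
        ((a * (2 * h) + c + 1).choose 2 : ℕ) + h * ((2 * h - 1 - 2 * c) * (2 * a + 1)) := by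
      push_cast at h1 h2
      linarith
    have o1 : Odd ((((2 * h : ℕ) : ℤ)) - 1 - 2 * c) := ⟨h - 1 - c, by push_cast; ring⟩
    have o2 : Odd ((2 * (h : ℤ) - 1 - 2 * c) * (2 * a + 1)) :=
      Odd.mul ⟨h - 1 - c, by ring⟩ ⟨a, rfl⟩
    rw [e1, zpow_add₀ hζ0, zpow_mul, zpow_natCast ζ h, hh, o1.neg_one_zpow, o2.neg_one_zpow]
    ring
  · have e1 : (((a * (2 * h + 1) + (2 * h + 1 - 1 - c) + 1).choose 2 : ℕ) : ℤ) =
        ((a * (2 * h + 1) + c + 1).choose 2 : ℕ) +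
          (2 * h + 1 : ℕ) * ((h - c) * (2 * a + 1)) := by
      push_cast at h1 h2 ⊢
      linarith
    have o1 : Even ((((2 * h + 1 : ℕ) : ℤ)) - 1 - 2 * c) := ⟨h - c, by push_cast; ring⟩
    rw [zpow_eq_of_eq_add_mul hζ hζ0 e1, o1.neg_one_zpow, mul_one]

end QBallot

theorem theorem1p3 (n s r j : ℕ) (hn : 1 ≤ n) (hs : 1 ≤ s) (hrs : Odd (r + s)) (hj : j ≤ s) :
    QBallot.LaurentModEq (QBallot.qBinom (2 * n) n)
      (∑ k ∈ Finset.range (n + 1),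
        QBallot.q ^ ((j : ℤ) * ((k : ℤ) ^ 2 + k) - r * k)
          * QBallot.qInt (2 * k + 1) ^ r * QBallot.qBallot n k ^ s) 0 ∧
    QBallot.LaurentModEq (QBallot.qBinom (2 * n) n)
      (∑ k ∈ Finset.range (n + 1),
        (-1) ^ k * QBallot.q ^ ((k.choose 2 : ℤ) + j * ((k : ℤ) ^ 2 + k) - ((r : ℤ) - 1) * k)
          * QBallot.qInt (2 * k + 1) ^ r * QBallot.qBallot n k ^ s) 0 ∧
    ((2 * n).choose n : ℤ) ∣
      ∑ k ∈ Finset.range (n + 1), (2 * (k : ℤ) + 1) ^ r * QBallot.ballot n k ^ s ∧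
    ((2 * n).choose n : ℤ) ∣
      ∑ k ∈ Finset.range (n + 1), (-1) ^ k * (2 * (k : ℤ) + 1) ^ r * QBallot.ballot n k ^ s := by
  obtain ⟨h1, h2⟩ := QBallot.ballotSum_divisible (n := n) (σ := fun _ => 1)
    (e := fun k => j * (k ^ 2 + k)) hs hrs fun d ζ hζ a c hc => by
      rw [QBallot.pow_sq_add_self_reflect hζ j a hc]
  -- Since `C(k,2) + k = C(k+1,2)`, the exponent `C(k,2) - (r-1)k` becomes `C(k+1,2) - rk`.
  obtain ⟨h3, h4⟩ := QBallot.ballotSum_divisible (n := n) (σ := fun k => (-1) ^ k)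
    (e := fun k => (k + 1).choose 2 + j * (k ^ 2 + k)) hs hrs fun d ζ hζ a c hc => by
      have h := QBallot.neg_one_pow_mul_pow_choose_reflect hζ a hc
      push_cast
      rw [pow_add ζ, pow_add ζ, QBallot.pow_sq_add_self_reflect hζ j a hc, ← mul_assoc, ← mul_assoc, h]
  refine ⟨?_, ?_, ?_, h4⟩
  · convert h1 using 4 with k
    simp
  · convert h3 using 6 with k
    · simp
    · have := Nat.choose_succ_succ k 1
      simp only [Nat.choose_one_right] at this
      push_cast [this]
      ring
  · simpa using h2
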